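/- Let $K$ be an algebraically closed field of arbitrary characteristic, $n\ge 1$, $R=K[[x_1,\dots,x_n]]$, and let $\mathfrak m$ be the maximal ideal of $R$. **$C$-polytopes.** Let $w_1,\dots,w_k\in\mathbb Q_{>0}^n$ ($k\ge1$) be weight vectors, put $\lambda_P(r)=\min_j w_j\cdot r$ for $r\in\mathbb R^n$, and assume that no $w_j$ is superfluous, i.e. for each $j$ there is $r\in\mathbb R_{\ge0}^n$ with $w_j\cdot r<w_i\cdot r$ for all $i\ne j$. The set $P=\{r\in\mathbb R^n_{\ge0}\mid\lambda_P(r)=1\}$ is called a $C$-polytope; it determines the $w_j$ (the normal vectors of its facets). Let $N_P$ be the lowest common multiple of the denominators of all entries of the $w_j$. For $f=\sum_\alpha a_\alpha x^\alpha\in R$ put $v_P(f)=\min\{N_P\lambda_P(\alpha)\mid a_\alpha\ne0\}$, $v_P(0)=\infty$; for a $K$-derivation $\xi=\sum_{i,\alpha}a_{i,\alpha}x^\alpha\partial_{x_i}$ of $R$ put $v_P(\xi)=\min\{N_P\lambda_P(\alpha-e_i)\mid a_{i,\alpha}\neq0\}$, $v_P(0)=\infty$. Let $F_d=\{f\in R\mid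 v_P(f)\ge d\}$ for $d\in\mathbb N$, and let the initial form $\mathrm{In}_P(f)$ be the sum of those terms $a_\alpha x^\alpha$ of $f$, $a_\alpha\neq 0$, for which $\lambda_P(\alpha)$ is minimal. **Tjurina algebra.** Let $\mathrm{tj}(f)=\langle f,\partial_{x_1}f,\dots,\partial_{x_n}f\rangle$, $T_f=R/\mathrm{tj}(f)$ and $$\mathrm{tj}^{AC}_P(f)_d=\{g f+\xi f\mid g\in R,\ \xi\in\mathrm{Der}_K(R),\ \min\{v_P(g)+v_P(f),\,v_P(\xi)+v_P(f)\}\ge d\},$$ $$\mathrm{gr}_P^{AC}(T_f)=\bigoplus_{d\ge0}F_d\big/\big(\mathrm{tj}_P^{AC}(f)_d+F_{d+1}\big).$$ The power series $f$ satisfies AAC with respect to $P$ if $\dim_K\mathrm{gr}_P^{AC}(T_f)<\infty$, and it is cSPH with respect to $P$ if $\dim_KT_{\mathrm{In}_P(f)}<\infty$. A regular basis for $T_f$ is a set $B$ of monomials $x^\alpha$ whose classes in $\mathrm{gr}_P^{AC}(T_f)$ (the class of $x^\alpha$ being taken in degree $v_P(x^\alpha)$) form a $K$-basis. **Contact equivalence.**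 Write $f\sim_c g$ if $f=u\cdot\varphi(g)$ for a unit $u\in R^*$ and a $K$-algebra automorphism $\varphi$ of $R$. The series $f$ is finitely contact determined if there is $k\in\mathbb N$ such that $f\sim_c g$ for every $g\in R$ that has the same terms of degree $\le k$ as $f$. **Corollary (Normal forms for contact equivalence).** Let $P$ be a $C$-polytope and let $f\in\mathfrak m$ be such that $\mathrm{In}_P(f)$ satisfies AAC with respect to $P$. Then $f$ is finitely contact determined and $f$ is cSPH with respect to $P$. Moreover, $T_{\mathrm{In}_P(f)}$ has a finite regular basis, every regular basis $B$ for $T_{\mathrm{In}_P(f)}$ is finite, and for every such $B$ there are $c_\alpha\in K$ with $$f\ \sim_c\ \mathrm{In}_P(f)+\sum_{x^\alpha\in B,\ v_P(x^\alpha)>d}c_\alpha x^\alpha,\qquad d=v_P(\mathrm{In}_P(f)).$$ -/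

import Mathlib

open scoped BigOperators

noncomputable section

/-! ### `C`-polytopes -/

/-- A `C`-polytope in `ℝ^n`, given by the (nonempty, finite) set of weight vectors, i.e. of the inner
normal vectors of its facets, scaled so that the facet lies in `{r | w · r = 1}`.  The weights
are positive and rational, and irredundant: each of the linear forms `r ↦ w · r` is somewhere in the
positive orthant strictly smaller than all the others, so that each of them defines a facet.
The polytope itself is `CPolytope.carrier`. -/
structure CPolytope (n : ℕ) where
  weights : Finset (Fin n → ℚ)
  nonempty : weights.Nonempty
  pos : ∀ w ∈ weights, ∀ i, 0 < w i
  irredundant : ∀ w ∈ weights, ∃ r : Fin n → ℝ, (∀ i, 0 ≤ r i) ∧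
    ∀ w' ∈ weights, w' ≠ w → ∑ i, (w i : ℝ) * r i < ∑ i, (w' i : ℝ) * r i

namespace CPolytope

variable {n : ℕ} (P : CPolytope n)

/-- The concave piecewise linear function `λ_P(r) = min_w (w · r)` on `ℝ^n`. -/
def lam (r : Fin n → ℝ) : ℝ :=
  P.weights.inf' P.nonempty fun w => ∑ i, (w i : ℝ) * r i

/-- The point set `P = {r ∈ ℝ_{≥0}^n | λ_P(r) = 1}`. -/
def carrier : Set (Fin n → ℝ) :=
  {r | (∀ i, 0 ≤ r i) ∧ P.lam r = 1}

/-- `N_P`: the lowest common multiple of the denominators of all entries of the weight vectors. -/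
def N : ℕ :=
  P.weights.lcm fun w => Finset.univ.lcm fun i => (w i).den

/-- The scaled function `N_P · λ_P`. -/
def wt (r : Fin n → ℝ) : ℝ :=
  (P.N : ℝ) * P.lam r

/-- An exponent `α ∈ ℕ^n` as a point of `ℝ^n`. -/
def point (α : Fin n →₀ ℕ) : Fin n → ℝ := fun i => (α i : ℝ)

/-- The natural number `v_P(x^α) = N_P · λ_P(α)`; the floor is harmless by `deg_eq_wt`. -/
def deg (α : Fin n →₀ ℕ) : ℕ :=
  ⌊P.wt (point α)⌋₊

/-- `N_P · λ_P` takes values in `ℕ` on `ℕ^n`. -/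
theorem deg_eq_wt (α : Fin n →₀ ℕ) : (P.deg α : ℝ) = P.wt (point α) := by
  suffices h : ∃ m : ℕ, P.wt (point α) = m by
    obtain ⟨m, hm⟩ := h
    simp [deg, hm]
  obtain ⟨w, hw, hlam⟩ := Finset.exists_mem_eq_inf' P.nonempty
    (fun w : Fin n → ℚ => ∑ i, (w i : ℝ) * point α i)
  have key : ∀ i, ∃ m : ℕ, (P.N : ℝ) * (w i : ℝ) = m := by
    intro i
    have hd : (w i).den ∣ P.N :=
      (Finset.dvd_lcm (f := fun i => (w i).den) (Finset.mem_univ i)).trans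
        (Finset.dvd_lcm (f := fun w : Fin n → ℚ => Finset.univ.lcm fun i => (w i).den) hw)
    obtain ⟨c, hc⟩ := hd
    refine ⟨c * (w i).num.toNat, ?_⟩
    have hnum : (((w i).num.toNat : ℤ)) = (w i).num :=
      Int.toNat_of_nonneg (Rat.num_nonneg.2 (P.pos w hw i).le)
    have h1 : ((w i).den : ℚ) * w i = (w i).num := by
      rw [mul_comm]; exact Rat.mul_den_eq_num _
    have h2 : (P.N : ℚ) * w i = ((c * (w i).num.toNat : ℕ) : ℚ) := by
      rw [hc]
      push_cast
      have h3 : (((w i).num.toNat : ℕ) : ℚ) = ((w i).num : ℚ) := by exact_mod_cast hnum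
      rw [h3, ← h1]
      ring
    exact_mod_cast congrArg (Rat.cast : ℚ → ℝ) h2
  choose m hm using key
  refine ⟨∑ i, m i * α i, ?_⟩
  rw [wt, lam, hlam, Finset.mul_sum]
  push_cast
  refine Finset.sum_congr rfl fun i _ => ?_
  rw [← hm i, point]
  ring

/-- Larger exponents have larger valuation. -/
theorem wt_mono {r s : Fin n → ℝ} (h : ∀ i, r i ≤ s i) : P.wt r ≤ P.wt s := by
  refine mul_le_mul_of_nonneg_left ?_ (Nat.cast_nonneg _)
  refine Finset.le_inf' _ _ fun w hw => (Finset.inf'_le _ hw).trans ?_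
  refine Finset.sum_le_sum fun i _ => mul_le_mul_of_nonneg_left (h i) ?_
  exact_mod_cast (P.pos w hw i).le

variable {K : Type*} [Field K]

/-- The piecewise valuation `v_P(f) = min {N_P λ_P(α) | α ∈ supp f}`, with `v_P(0) = ⊤ = ∞`. -/
def val (f : MvPowerSeries (Fin n) K) : EReal :=
  ⨅ (α : Fin n →₀ ℕ) (_ : MvPowerSeries.coeff α f ≠ 0), ((P.wt (point α) : ℝ) : EReal)

/-- The valuation of a derivation `ξ = ∑ a_{i,α} x^α ∂_i`, namely the minimum of
`v_P(x^α ∂_i) = N_P λ_P(α - e_i)` over the pairs `(i, α)` with `a_{i,α} ≠ 0`, and `∞` for `ξ = 0`.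
Here `a_{i,α}` is the coefficient of `x^α` in `ξ(x_i)`. -/
def valDer (ξ : Derivation K (MvPowerSeries (Fin n) K) (MvPowerSeries (Fin n) K)) : EReal :=
  ⨅ (i : Fin n) (α : Fin n →₀ ℕ) (_ : MvPowerSeries.coeff α (ξ (MvPowerSeries.X i)) ≠ 0),
    ((P.wt (point α - Pi.single i 1) : ℝ) : EReal)

theorem min_val_le_val_add (f g : MvPowerSeries (Fin n) K) :
    min (P.val f) (P.val g) ≤ P.val (f + g) := by
  refine le_iInf₂ fun α hα => ?_
  by_cases hf : MvPowerSeries.coeff α f = 0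
  · have hg : MvPowerSeries.coeff α g ≠ 0 := by
      intro hg; exact hα (by simp [hf, hg])
    exact (min_le_right _ _).trans (iInf₂_le α hg)
  · exact (min_le_left _ _).trans (iInf₂_le α hf)

theorem exists_le_of_coeff_mul_ne_zero {h f : MvPowerSeries (Fin n) K} {α : Fin n →₀ ℕ}
    (hα : MvPowerSeries.coeff α (h * f) ≠ 0) : ∃ β ≤ α, MvPowerSeries.coeff β f ≠ 0 := by
  classical
  rw [MvPowerSeries.coeff_mul] at hα
  obtain ⟨p, hp, hne⟩ := Finset.exists_ne_zero_of_sum_ne_zero hα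
  refine ⟨p.2, ?_, right_ne_zero_of_mul hne⟩
  rw [← Finset.HasAntidiagonal.mem_antidiagonal.1 hp]
  exact le_add_self

theorem val_le_val_mul (h f : MvPowerSeries (Fin n) K) : P.val f ≤ P.val (h * f) := by
  refine le_iInf₂ fun α hα => ?_
  obtain ⟨β, hβ, hne⟩ := exists_le_of_coeff_mul_ne_zero hα
  refine (iInf₂_le β hne).trans (EReal.coe_le_coe_iff.2 (P.wt_mono fun i => ?_))
  exact Nat.cast_le.2 (hβ i)

theorem min_valDer_le_valDer_add
    (ξ η : Derivation K (MvPowerSeries (Fin n) K) (MvPowerSeries (Fin n) K)) :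
    min (P.valDer ξ) (P.valDer η) ≤ P.valDer (ξ + η) := by
  refine le_iInf fun i => le_iInf₂ fun α hα => ?_
  by_cases hf : MvPowerSeries.coeff α (ξ (MvPowerSeries.X i)) = 0
  · have hg : MvPowerSeries.coeff α (η (MvPowerSeries.X i)) ≠ 0 := by
      intro hg; exact hα (by simp [hf, hg])
    exact (min_le_right _ _).trans ((iInf_le _ i).trans (iInf₂_le α hg))
  · exact (min_le_left _ _).trans ((iInf_le _ i).trans (iInf₂_le α hf))

theorem valDer_le_valDer_smul (h : MvPowerSeries (Fin n) K)
    (ξ : Derivation K (MvPowerSeries (Fin n) K) (MvPowerSeries (Fin n) K)) :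
    P.valDer ξ ≤ P.valDer (h • ξ) := by
  refine le_iInf fun i => le_iInf₂ fun α hα => ?_
  rw [Derivation.smul_apply, smul_eq_mul] at hα
  obtain ⟨β, hβ, hne⟩ := exists_le_of_coeff_mul_ne_zero hα
  refine ((iInf_le _ i).trans (iInf₂_le β hne)).trans
    (EReal.coe_le_coe_iff.2 (P.wt_mono fun j => ?_))
  exact sub_le_sub_right (Nat.cast_le.2 (hβ j)) _

/-- The ideal `F_d = {f | v_P(f) ≥ d}`. -/
def filt (K : Type*) [Field K] (d : ℕ) : Ideal (MvPowerSeries (Fin n) K) where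
  carrier := {f | (d : EReal) ≤ P.val f}
  add_mem' {f g} hf hg := (le_min hf hg).trans (P.min_val_le_val_add f g)
  zero_mem' := by simp [val]
  smul_mem' h f hf := le_trans hf (P.val_le_val_mul h f)

/-- The initial form (principal part) `In_P(f)`: the sum of the terms `a_α x^α` of `f` with
`λ_P(α)` minimal among the exponents in the support of `f`. -/
def initialForm (f : MvPowerSeries (Fin n) K) : MvPowerSeries (Fin n) K := by
  classical
  exact fun α =>
    if ∀ β, MvPowerSeries.coeff β f ≠ 0 → P.lam (point α) ≤ P.lam (point β) then
      MvPowerSeries.coeff α f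
    else 0

/-- The ideal
`tj_P^{AC}(f)_d = {g f + ξ f | min {v_P(g) + v_P(f), v_P(ξ) + v_P(f)} ≥ d}`, where `g` runs through
the power series and `ξ` through the `K`-derivations of the power series ring. -/
def tjAC (f : MvPowerSeries (Fin n) K) (d : ℕ) : Ideal (MvPowerSeries (Fin n) K) where
  carrier := {h | ∃ (g : MvPowerSeries (Fin n) K)
    (ξ : Derivation K (MvPowerSeries (Fin n) K) (MvPowerSeries (Fin n) K)),
    h = g * f + ξ f ∧ (d : EReal) ≤ min (P.val g + P.val f) (P.valDer ξ + P.val f)}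
  add_mem' := by
    rintro _ _ ⟨g, ξ, rfl, h⟩ ⟨g', ξ', rfl, h'⟩
    refine ⟨g + g', ξ + ξ', by rw [Derivation.add_apply]; ring, ?_⟩
    rw [le_min_iff] at h h' ⊢
    constructor
    · refine le_trans ?_ (add_le_add_left (P.min_val_le_val_add g g') _)
      rcases le_total (P.val g) (P.val g') with hh | hh
      · rw [min_eq_left hh]; exact h.1
      · rw [min_eq_right hh]; exact h'.1
    · refine le_trans ?_ (add_le_add_left (P.min_valDer_le_valDer_add ξ ξ') _)
      rcases le_total (P.valDer ξ) (P.valDer ξ') with hh | hh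
      · rw [min_eq_left hh]; exact h.2
      · rw [min_eq_right hh]; exact h'.2
  zero_mem' := by
    have hv : ∀ f : MvPowerSeries (Fin n) K, P.val f ≠ ⊥ := by
      intro f hf
      have : (0 : EReal) ≤ P.val f := le_iInf₂ fun α _ => by
        rw [← P.deg_eq_wt α]; exact_mod_cast Nat.zero_le _
      rw [hf] at this
      exact absurd this (by simp)
    refine ⟨0, 0, by simp, ?_⟩
    have h1 : P.val (0 : MvPowerSeries (Fin n) K) = ⊤ := by simp [val]
    have h2 : P.valDer (0 : Derivation K (MvPowerSeries (Fin n) K) (MvPowerSeries (Fin n) K)) = ⊤ := by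
      simp [valDer]
    rw [h1, h2, EReal.top_add_of_ne_bot (hv f), min_self]
    exact le_top
  smul_mem' := by
    rintro h _ ⟨g, ξ, rfl, hd⟩
    refine ⟨h * g, h • ξ, by rw [Derivation.smul_apply, smul_eq_mul, smul_eq_mul]; ring, ?_⟩
    rw [le_min_iff] at hd ⊢
    exact ⟨hd.1.trans (add_le_add_left (P.val_le_val_mul h g) _),
      hd.2.trans (add_le_add_left (P.valDer_le_valDer_smul h ξ) _)⟩

/-- The degree `d` part `F_d / (tj_P^{AC}(f)_d + F_{d+1})` of `gr_P^{AC}(T_f)`. -/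
def grPiece (f : MvPowerSeries (Fin n) K) (d : ℕ) : Type _ :=
  ↥(P.filt K d) ⧸ (P.tjAC f d ⊔ P.filt K (d + 1)).submoduleOf (P.filt K d)

instance (f : MvPowerSeries (Fin n) K) (d : ℕ) : AddCommGroup (P.grPiece f d) :=
  inferInstanceAs (AddCommGroup
    (↥(P.filt K d) ⧸ (P.tjAC f d ⊔ P.filt K (d + 1)).submoduleOf (P.filt K d)))

instance (f : MvPowerSeries (Fin n) K) (d : ℕ) : Module K (P.grPiece f d) :=
  inferInstanceAs (Module K
    (↥(P.filt K d) ⧸ (P.tjAC f d ⊔ P.filt K (d + 1)).submoduleOf (P.filt K d)))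

/-- The residue class map `F_d → F_d / (tj_P^{AC}(f)_d + F_{d+1})`. -/
def grMk (f : MvPowerSeries (Fin n) K) (d : ℕ) : ↥(P.filt K d) →ₗ[K] P.grPiece f d :=
  ((P.tjAC f d ⊔ P.filt K (d + 1)).submoduleOf (P.filt K d)).mkQ.restrictScalars K

/-- The graded `K`-vector space `gr_P^{AC}(T_f) = ⨁_{d ≥ 0} F_d / (tj_P^{AC}(f)_d + F_{d+1})`. -/
abbrev grAC (f : MvPowerSeries (Fin n) K) : Type _ :=
  DirectSum ℕ fun d => P.grPiece f d

/-- Condition AAC with respect to `P`: `dim_K gr_P^{AC}(T_f) < ∞`. -/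
def AAC (f : MvPowerSeries (Fin n) K) : Prop :=
  FiniteDimensional K (P.grAC f)

/-- The monomial `x^α` as an element of `F_d`, where `d = v_P(x^α)`. -/
def monomialFilt (K : Type*) [Field K] (α : Fin n →₀ ℕ) : ↥(P.filt K (P.deg α)) :=
  ⟨MvPowerSeries.monomial α (1 : K), by
    classical
    change ((P.deg α : ℕ) : EReal) ≤ P.val _
    refine le_iInf₂ fun β hβ => ?_
    rw [MvPowerSeries.coeff_monomial] at hβ
    have hβα : β = α := by
      by_contra hne
      exact hβ (if_neg hne)
    rw [hβα, ← P.deg_eq_wt α]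
    exact le_of_eq (EReal.coe_natCast).symm⟩

/-- The class of the monomial `x^α` in `gr_P^{AC}(T_f)`; it is homogeneous of degree `v_P(x^α)`. -/
def grMonomial (f : MvPowerSeries (Fin n) K) (α : Fin n →₀ ℕ) : P.grAC f :=
  DirectSum.lof K ℕ (fun d => P.grPiece f d) (P.deg α)
    (P.grMk f (P.deg α) (P.monomialFilt K α))

/-- `{x^α | α ∈ Λ}` is a regular basis for `T_f`: the classes of these monomials form a
`K`-basis of `gr_P^{AC}(T_f)`. -/
def IsRegularBasis (f : MvPowerSeries (Fin n) K) (Λ : Set (Fin n →₀ ℕ)) : Prop :=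
  LinearIndependent K (fun α : Λ => P.grMonomial f α) ∧
    Submodule.span K (P.grMonomial f '' Λ) = ⊤

end CPolytope

/-! ### Contact equivalence, determinacy and the Tjurina algebra -/

/-- `f ∼_c g`: there are a `K`-algebra automorphism `φ` of `K[[x]]` and a unit `u` with
`f = u · φ(g)`. -/
def ContactEquiv {n : ℕ} {K : Type*} [Field K] (f g : MvPowerSeries (Fin n) K) : Prop :=
  ∃ (φ : MvPowerSeries (Fin n) K ≃ₐ[K] MvPowerSeries (Fin n) K) (u : (MvPowerSeries (Fin n) K)ˣ),
    f = u * φ g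

/-- `f` is contact `k`-determined: it is contact equivalent to every `g` which has the same terms
of total degree at most `k`. -/
def ContactDetermined {n : ℕ} {K : Type*} [Field K] (k : ℕ) (f : MvPowerSeries (Fin n) K) : Prop :=
  ∀ g : MvPowerSeries (Fin n) K,
    (∀ α : Fin n →₀ ℕ, α.degree ≤ k → MvPowerSeries.coeff α g = MvPowerSeries.coeff α f) →
      ContactEquiv f g

/-- `f` is finitely contact determined. -/
def FinitelyContactDetermined {n : ℕ} {K : Type*} [Field K] (f : MvPowerSeries (Fin n) K) : Prop :=
  ∃ k : ℕ, ContactDetermined k f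

/-- The Tjurina ideal `tj(f) = ⟨f, ∂f/∂x_1, …, ∂f/∂x_n⟩`. -/
def tjurinaIdeal {n : ℕ} {K : Type*} [Field K] (f : MvPowerSeries (Fin n) K) :
    Ideal (MvPowerSeries (Fin n) K) :=
  Ideal.span (insert f (Set.range fun i => MvPowerSeries.pderiv K i f))

/-- The Tjurina algebra `T_f = K[[x]] / tj(f)`. -/
abbrev TjurinaAlgebra {n : ℕ} {K : Type*} [Field K] (f : MvPowerSeries (Fin n) K) : Type _ :=
  MvPowerSeries (Fin n) K ⧸ tjurinaIdeal f

/-- `f` is contact semi-piecewise homogeneous (cSPH) with respect to `P`: the Tjurina number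
`τ(In_P(f)) = dim_K T_{In_P(f)}` is finite. -/
def CPolytope.CSPH {n : ℕ} (P : CPolytope n) {K : Type*} [Field K]
    (f : MvPowerSeries (Fin n) K) : Prop :=
  FiniteDimensional K (TjurinaAlgebra (P.initialForm f))

end

/-! Write f₀ for the initial form of f and d for its valuation. The engine is a single contact step
(`exists_contact_step`). Let h = g f₀ + ξ f₀ lie in the tangent space of level D > d and put e = D -
d ≥ 1. Then g has valuation at least e, and ξ raises the weight of every facet by at least e. If p
is f₀ plus terms of valuation above d, the substitution x_i ↦ x_i - ξ(x_i) followed by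
multiplication with 1 - g turns p into p - h up to valuation above D: second order effects start at
d + 2e > D, and replacing f₀ by p in g f₀ + ξ f₀ costs only terms of valuation at least d + 1 + e.
No Taylor coefficients occur, so the characteristic plays no role.

Since e grows with D, such steps can be composed infinitely often, and the limit is again a contact
transformation (`contactEquiv_of_limit`, `exists_contactEquiv_add`). AAC makes the graded pieces
vanish in large degrees (`AAC.exists_forall_mem_tjAC`), so there the steps remove everything, which
gives finite determinacy. Starting just above d, they remove everything except combinations of
regular basis monomials (`IsRegularBasis.exists_sub_mem`), which gives the normal form. The same
successive approximation, applied to the generators of the Tjurina ideal instead of to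
transformations, shows that this ideal contains all series of large valuation
(`finiteDimensional_tjurinaAlgebra`).

The valuation is a minimum of linear weights, so all estimates are made for one facet at a time
(`mem_suppGE_deg_iff`). -/

noncomputable section

/-! ### Filtrations of the power series ring and their completeness -/

namespace MvPowerSeries

open Finsupp

variable {n : ℕ} {K : Type*} [Field K]

/-- The power series with prescribed coefficients. -/
def ofCoeff (a : (Fin n →₀ ℕ) → K) : MvPowerSeries (Fin n) K := a

@[simp]
theorem coeff_ofCoeff (a : (Fin n →₀ ℕ) → K) (α : Fin n →₀ ℕ) : coeff α (ofCoeff a) = a α := rfl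

theorem monomial_add_one (α β : Fin n →₀ ℕ) :
    (monomial (α + β) 1 : MvPowerSeries (Fin n) K) = monomial α 1 * monomial β 1 := by
  rw [monomial_mul_monomial, one_mul]

/-- Induction on exponents along addition, starting from the exponents of the variables. -/
theorem exponent_induction {p : (Fin n →₀ ℕ) → Prop} (zero : p 0)
    (add : ∀ α β, p α → p β → p (α + β)) (single : ∀ i, p (Finsupp.single i 1))
    (α : Fin n →₀ ℕ) : p α := by
  induction α using Finsupp.induction_linear with
  | zero => exact zero
  | add α β hα hβ => exact add α β hα hβ
  | single i b =>
    induction b with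
    | zero => rwa [Finsupp.single_zero]
    | succ b ih => rw [Finsupp.single_add]; exact add _ _ ih (single i)

/-- The power series all of whose exponents `α` satisfy `k ≤ v α`. -/
def suppGE (K : Type*) [Field K] (v : (Fin n →₀ ℕ) → ℕ) (k : ℕ) :
    Submodule K (MvPowerSeries (Fin n) K) where
  carrier := {f | ∀ α, v α < k → coeff α f = 0}
  add_mem' hf hg α h := by rw [map_add, hf α h, hg α h, add_zero]
  zero_mem' α _ := map_zero _
  smul_mem' c f hf α h := by rw [map_smul, hf α h, smul_zero]

section suppGE

variable {v : (Fin n →₀ ℕ) → ℕ} {k l : ℕ} {f g : MvPowerSeries (Fin n) K}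

theorem mem_suppGE : f ∈ suppGE K v k ↔ ∀ α, v α < k → coeff α f = 0 := Iff.rfl

theorem mem_suppGE' : f ∈ suppGE K v k ↔ ∀ α, coeff α f ≠ 0 → k ≤ v α := by
  rw [mem_suppGE]
  exact forall_congr' fun α => by rw [← not_imp_not, not_lt]

theorem suppGE_anti (h : k ≤ l) : suppGE K v l ≤ suppGE K v k :=
  fun _ hf α hα => hf α (hα.trans_le h)

theorem suppGE_zero : suppGE K v 0 = ⊤ :=
  top_unique fun _ _ _ h => absurd h (Nat.not_lt_zero _)

theorem eq_zero_of_forall_mem_suppGE (h : ∀ k, f ∈ suppGE K v k) : f = 0 := by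
  ext α
  exact h (v α + 1) α (Nat.lt_succ_self _)

theorem monomial_mem_suppGE (α : Fin n →₀ ℕ) (c : K) (h : k ≤ v α) :
    monomial α c ∈ suppGE K v k := by
  classical
  intro β hβ
  rw [coeff_monomial, if_neg]
  rintro rfl
  omega

theorem sub_sum_monomial_mem_suppGE (hv : {α | v α < k}.Finite) (f : MvPowerSeries (Fin n) K) :
    f - ∑ α ∈ hv.toFinset, monomial α (coeff α f) ∈ suppGE K v k := by
  classical
  intro β hβ
  rw [map_sub, map_sum, Finset.sum_eq_single β]
  · rw [coeff_monomial_same, sub_self]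
  · intro α _ hne
    rw [coeff_monomial, if_neg hne.symm]
  · intro h
    exact absurd (hv.mem_toFinset.2 hβ) h

/-- A linear map which respects the filtration by `v` and raises it by `c` on monomials raises it
by `c`. -/
theorem map_mem_suppGE_add (hv : ∀ k, {α | v α < k}.Finite)
    (E : MvPowerSeries (Fin n) K →ₗ[K] MvPowerSeries (Fin n) K) (c : ℕ)
    (hE : ∀ k, ∀ f ∈ suppGE K v k, E f ∈ suppGE K v k)
    (hmon : ∀ α, E (monomial α 1) ∈ suppGE K v (v α + c)) (hf : f ∈ suppGE K v k) :
    E f ∈ suppGE K v (k + c) := by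
  -- Only finitely many monomials lie below level `k + c`: `hmon` treats these, and `hE` treats the
  -- tail.
  have h := sub_sum_monomial_mem_suppGE (hv (k + c)) f
  have h2 := hE _ _ h
  rw [map_sub, map_sum] at h2
  rw [← sub_add_cancel (E f) (∑ α ∈ (hv (k + c)).toFinset, E (monomial α (coeff α f)))]
  refine add_mem h2 (sum_mem fun α _ => ?_)
  by_cases hα : coeff α f = 0
  · rw [hα, map_zero, map_zero]; exact zero_mem _
  · have : monomial α (coeff α f) = coeff α f • (monomial α 1 : MvPowerSeries (Fin n) K) := by
      rw [← map_smul, smul_eq_mul, mul_one]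
    rw [this, map_smul]
    exact Submodule.smul_mem _ _ (suppGE_anti (by
      have := mem_suppGE'.1 hf α hα; omega) (hmon α))

/-- Completeness of the power series ring with respect to the filtration by `v`. -/
theorem exists_limit (h : ℕ → MvPowerSeries (Fin n) K)
    (hh : ∀ j, h (j + 1) - h j ∈ suppGE K v j) :
    ∃ g, ∀ j, g - h j ∈ suppGE K v j := by
  have key : ∀ j i, h (j + i) - h j ∈ suppGE K v j := by
    intro j i
    induction i with
    | zero => simp
    | succ i ih =>
      rw [← sub_add_sub_cancel _ (h (j + i))]
      exact add_mem (suppGE_anti (by omega) (hh (j + i))) ih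
  -- The coefficient at `α` no longer changes from index `v α + 1` on.
  refine ⟨ofCoeff fun α => coeff α (h (v α + 1)), fun j α hα => ?_⟩
  obtain ⟨i, rfl⟩ := Nat.exists_eq_add_of_lt hα
  have := key (v α + 1) i α (Nat.lt_succ_self _)
  rw [map_sub, sub_eq_zero] at this ⊢
  rw [show v α + i + 1 = v α + 1 + i by ring, this, coeff_ofCoeff]

end suppGE

/-! ### One linear weight: products, derivations, substitutions -/

section weight

variable {m : Fin n → ℕ} {k l : ℕ} {f g : MvPowerSeries (Fin n) K}

theorem mem_suppGE_weight : f ∈ suppGE K (weight m) k ↔ (k : ℕ∞) ≤ f.weightedOrder m :=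
  ⟨fun h => nat_le_weightedOrder m h, fun h α hα =>
    coeff_eq_zero_of_lt_weightedOrder m (lt_of_lt_of_le (by exact_mod_cast hα) h)⟩

theorem mul_mem_suppGE_weight (hf : f ∈ suppGE K (weight m) k) (hg : g ∈ suppGE K (weight m) l) :
    f * g ∈ suppGE K (weight m) (k + l) := by
  rw [mem_suppGE_weight] at *
  push_cast
  exact (add_le_add hf hg).trans (le_weightedOrder_mul m)

theorem X_mem_suppGE_weight (i : Fin n) :
    (X i : MvPowerSeries (Fin n) K) ∈ suppGE K (weight m) (m i) :=
  monomial_mem_suppGE _ _ (by simp [weight_single])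

theorem prod_pow_mem_suppGE_weight {a : Fin n → MvPowerSeries (Fin n) K}
    (ha : ∀ i, a i ∈ suppGE K (weight m) (m i)) (α : Fin n →₀ ℕ) :
    (α.prod fun i c => a i ^ c) ∈ suppGE K (weight m) (weight m α) := by
  rw [mem_suppGE_weight, Finsupp.prod]
  refine le_trans ?_ (le_weightedOrder_prod m _ _)
  rw [weight_apply, Finsupp.sum]
  push_cast
  refine Finset.sum_le_sum fun i _ => le_trans ?_ (le_weightedOrder_pow m _)
  rw [nsmul_eq_mul, Nat.cast_mul, nsmul_eq_mul, Nat.cast_id]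
  exact mul_le_mul_right (mem_suppGE_weight.1 (ha i)) _

/-- Each nonconstant monomial is assigned to one variable dividing it, so the summands collect
disjoint sets of monomials of `f`. -/
theorem exists_eq_sum_X_mul (hf : f ∈ suppGE K (weight (1 : Fin n → ℕ)) (k + 1)) :
    ∃ g : Fin n → MvPowerSeries (Fin n) K, f = ∑ i, X i * g i ∧
      ∀ i, g i ∈ suppGE K (weight (1 : Fin n → ℕ)) k := by
  classical
  have hex : ∀ α : Fin n →₀ ℕ, α ≠ 0 → ∃ i, α i ≠ 0 := fun α h => Finsupp.ne_iff.1 h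
  let idx : (α : Fin n →₀ ℕ) → α ≠ 0 → Fin n := fun α h => (hex α h).choose
  have hidx : ∀ (α : Fin n →₀ ℕ) (h : α ≠ 0), α (idx α h) ≠ 0 := fun α h => (hex α h).choose_spec
  refine ⟨fun i => ofCoeff fun β => if h : β + single i 1 ≠ 0 then
    if idx (β + single i 1) h = i then coeff (β + single i 1) f else 0 else 0, ?_, ?_⟩
  · ext α
    rw [map_sum]
    simp only [X, coeff_monomial_mul, one_mul, coeff_ofCoeff]
    by_cases hα : α = 0
    · subst hα
      rw [hf 0 (by simp), Finset.sum_eq_zero]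
      intro i _
      rw [if_neg]
      intro h
      simpa using h i
    · rw [Finset.sum_eq_single (idx α hα)]
      · have hle : single (idx α hα) 1 ≤ α := by
          rw [Finsupp.single_le_iff]; exact Nat.one_le_iff_ne_zero.2 (hidx α hα)
        rw [if_pos hle]
        simp only [tsub_add_cancel_of_le hle]
        rw [dif_pos hα, if_pos trivial]
      · intro i _ hne
        by_cases hle : single i 1 ≤ α
        · rw [if_pos hle]
          simp only [tsub_add_cancel_of_le hle]
          rw [dif_pos hα, if_neg hne.symm]
        · rw [if_neg hle]
      · simp
  · intro i β hβ
    rw [coeff_ofCoeff]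
    split_ifs
    · exact hf _ (by rw [map_add, weight_single]; simpa using hβ)
    · rfl
    · rfl

/-- `K`-derivations of the power series ring are continuous, hence given by their values on the
variables. -/
theorem derivation_apply_eq_sum
    (ξ : Derivation K (MvPowerSeries (Fin n) K) (MvPowerSeries (Fin n) K))
    (f : MvPowerSeries (Fin n) K) : ξ f = ∑ i, ξ (X i) * pderiv K i f := by
  classical
  let η : Derivation K (MvPowerSeries (Fin n) K) (MvPowerSeries (Fin n) K) :=
    ξ - ∑ i, ξ (X i) • pderiv K i
  have hη : ∀ g, η g = ξ g - ∑ i, ξ (X i) * pderiv K i g := by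
    intro g
    rw [Derivation.sub_apply, ← Derivation.coeFnAddMonoidHom_apply (∑ i, _), map_sum,
      Finset.sum_apply]
    rfl
  have hX : ∀ i, η (X i) = 0 := by
    intro i
    rw [hη, Finset.sum_eq_single i]
    · rw [pderiv_X_self, mul_one, sub_self]
    · intro j _ hne
      rw [pderiv_X_of_ne hne.symm, mul_zero]
    · simp
  -- Since `η` kills the variables, it commutes with multiplication by them; pulling out one
  -- variable at a time gives continuity.
  have hcont : ∀ k, ∀ g ∈ suppGE K (weight (1 : Fin n → ℕ)) k,
      η g ∈ suppGE K (weight (1 : Fin n → ℕ)) k := by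
    intro k
    induction k with
    | zero => intro g _; rw [suppGE_zero]; trivial
    | succ k ih =>
      intro g hg
      obtain ⟨c, rfl, hc⟩ := exists_eq_sum_X_mul hg
      rw [map_sum]
      refine sum_mem fun i _ => ?_
      rw [Derivation.leibniz, hX, smul_zero, add_zero, smul_eq_mul, add_comm]
      exact mul_mem_suppGE_weight (X_mem_suppGE_weight (m := 1) i) (ih _ (hc i))
  have hmon : ∀ α, η (monomial α 1) = 0 := by
    intro α
    induction α using exponent_induction with
    | zero => exact η.map_one_eq_zero
    | add α β hα hβ => rw [monomial_add_one, Derivation.leibniz, hα, hβ, smul_zero, smul_zero,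
        add_zero]
    | single i => exact hX i
  rw [← sub_eq_zero, ← hη]
  -- As `η` kills all monomials, it raises the filtration by every `k`.
  refine eq_zero_of_forall_mem_suppGE (v := weight (1 : Fin n → ℕ)) fun k => ?_
  have := map_mem_suppGE_add (v := weight (1 : Fin n → ℕ)) (k := 0) (f := f)
    (fun k => finite_of_nat_weight_lt _ (by simp) k) (η : _ →ₗ[K] _) k hcont
    (fun α => by rw [Derivation.coeFn_coe, hmon]; exact zero_mem _)
    (by rw [suppGE_zero]; trivial)
  simpa using this

/-- Each ∂_i lowers the weight by at most `m i`, and the factor `ξ (X i)` gives back `m i + e`. -/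
theorem derivation_mem_suppGE_weight
    (ξ : Derivation K (MvPowerSeries (Fin n) K) (MvPowerSeries (Fin n) K)) {e : ℕ}
    (hξ : ∀ i, ξ (X i) ∈ suppGE K (weight m) (m i + e)) (hf : f ∈ suppGE K (weight m) k) :
    ξ f ∈ suppGE K (weight m) (k + e) := by
  rw [derivation_apply_eq_sum]
  refine sum_mem fun i _ => ?_
  have h : pderiv K i f ∈ suppGE K (weight m) (k - m i) := by
    intro α hα
    rw [coeff_pderiv, hf, zero_mul]
    rw [map_add, weight_single, smul_eq_mul, one_mul]
    omega
  exact suppGE_anti (by omega) (mul_mem_suppGE_weight (hξ i) h)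

theorem substAlgHom_mem_suppGE_weight {a : Fin n → MvPowerSeries (Fin n) K} (hs : HasSubst a)
    (ha : ∀ i, a i ∈ suppGE K (weight m) (m i)) (hf : f ∈ suppGE K (weight m) k) :
    substAlgHom (R := K) hs f ∈ suppGE K (weight m) k := by
  intro α hα
  rw [substAlgHom_apply, coeff_subst hs]
  refine finsum_eq_zero_of_forall_eq_zero fun β => ?_
  by_cases hβ : weight m β < k
  · rw [hf β hβ, zero_smul]
  · rw [prod_pow_mem_suppGE_weight ha β α (by omega), smul_zero]

/-- A first order Taylor estimate without factorials: by continuity it suffices to treat monomials,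
where the error is zero on the variables and its bound is stable under products. -/
theorem substAlgHom_sub_mem_suppGE_weight {a : Fin n → MvPowerSeries (Fin n) K} (hs : HasSubst a)
    (hm : ∀ i, m i ≠ 0)
    (ξ : Derivation K (MvPowerSeries (Fin n) K) (MvPowerSeries (Fin n) K)) {e : ℕ}
    (hξ : ∀ i, ξ (X i) ∈ suppGE K (weight m) (m i + e)) (ha : ∀ i, a i = X i + ξ (X i))
    (hf : f ∈ suppGE K (weight m) k) :
    substAlgHom (R := K) hs f - f - ξ f ∈ suppGE K (weight m) (k + 2 * e) := by
  set φ := substAlgHom (R := K) hs with hφ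
  have hd : ∀ {k : ℕ} {f : MvPowerSeries (Fin n) K}, f ∈ suppGE K (weight m) k →
    ξ f ∈ suppGE K (weight m) (k + e) := fun h => derivation_mem_suppGE_weight ξ hξ h
  have ha' : ∀ i, a i ∈ suppGE K (weight m) (m i) := fun i => by
    rw [ha]; exact add_mem (X_mem_suppGE_weight i) (suppGE_anti (by omega) (hξ i))
  let E : MvPowerSeries (Fin n) K →ₗ[K] MvPowerSeries (Fin n) K :=
    φ.toLinearMap - LinearMap.id - (ξ : _ →ₗ[K] _)
  have hE : ∀ f, E f = φ f - f - ξ f := fun f => rfl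
  rw [← hE]
  refine map_mem_suppGE_add (fun k => finite_of_nat_weight_lt m hm k) E (2 * e) ?_ ?_ hf
  · intro k f hf
    rw [hE]
    exact sub_mem (sub_mem (substAlgHom_mem_suppGE_weight hs ha' hf) hf)
      (suppGE_anti (by omega) (hd hf))
  · intro α
    have hmul : ∀ (p q : MvPowerSeries (Fin n) K) (x y : ℕ), p ∈ suppGE K (weight m) x →
        q ∈ suppGE K (weight m) y → E p ∈ suppGE K (weight m) (x + 2 * e) →
        E q ∈ suppGE K (weight m) (y + 2 * e) → E (p * q) ∈ suppGE K (weight m) (x + y + 2 * e) := by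
      intro p q x y hp hq hEp hEq
      -- The failure of `E` to be a derivation comes from `ξ p * ξ q`, whose weight is already
      -- raised by `2 * e`.
      have h1 : E (p * q) = E p * φ q + (p + ξ p) * E q + ξ p * ξ q := by
        simp only [hE, map_mul, Derivation.leibniz, smul_eq_mul]; ring
      rw [h1]
      refine add_mem (add_mem ?_ ?_) ?_
      · exact suppGE_anti (by omega)
          (mul_mem_suppGE_weight hEp (substAlgHom_mem_suppGE_weight hs ha' hq))
      · exact suppGE_anti (by omega)
          (mul_mem_suppGE_weight (add_mem hp (suppGE_anti (by omega) (hd hp))) hEq)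
      · exact suppGE_anti (by omega) (mul_mem_suppGE_weight (hd hp) (hd hq))
    induction α using exponent_induction with
    | zero =>
      have : E (monomial 0 1) = 0 := by
        rw [monomial_zero_one, hE, map_one, Derivation.map_one_eq_zero, sub_self, sub_zero]
      rw [this]
      exact zero_mem _
    | add α β hα hβ =>
      rw [monomial_add_one, map_add]
      exact hmul _ _ _ _ (monomial_mem_suppGE _ _ le_rfl) (monomial_mem_suppGE _ _ le_rfl) hα hβ
    | single i =>
      have : E (monomial (Finsupp.single i 1) 1) = 0 := by
        change E (X i) = 0
        rw [hE, hφ, substAlgHom_X, ha]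
        ring
      rw [this]
      exact zero_mem _

end weight

end MvPowerSeries

/-! ### The piecewise filtration as an intersection of facet weight filtrations -/

namespace CPolytope

open MvPowerSeries Finsupp

variable {n : ℕ} {K : Type*} [Field K] (P : CPolytope n)

theorem N_pos : 0 < P.N := by
  rw [Nat.pos_iff_ne_zero, N, Ne, Finset.lcm_eq_zero_iff]
  rintro ⟨w, -, hw⟩
  rw [Finset.lcm_eq_zero_iff] at hw
  obtain ⟨i, -, hi⟩ := hw
  exact (w i).den_ne_zero hi

/-- The integral weight vector `N_P w`. -/
def facetWeight (w : Fin n → ℚ) (i : Fin n) : ℕ := ⌊(P.N : ℝ) * w i⌋₊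

theorem facetWeight_cast {w : Fin n → ℚ} (hw : w ∈ P.weights) (i : Fin n) :
    (P.facetWeight w i : ℝ) = P.N * w i := by
  suffices h : ∃ m : ℕ, (P.N : ℝ) * w i = m by
    obtain ⟨m, hm⟩ := h
    rw [facetWeight, hm, Nat.floor_natCast]
  obtain ⟨c, hc⟩ : (w i).den ∣ P.N :=
    (Finset.dvd_lcm (f := fun i => (w i).den) (Finset.mem_univ i)).trans
      (Finset.dvd_lcm (f := fun w : Fin n → ℚ => Finset.univ.lcm fun i => (w i).den) hw)
  obtain ⟨a, ha⟩ := Int.eq_ofNat_of_zero_le (Rat.num_nonneg.2 (P.pos w hw i).le)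
  have h1 : w i * (w i).den = a := by rw [Rat.mul_den_eq_num, ha]; rfl
  have h2 : (P.N : ℚ) * w i = ((c * a : ℕ) : ℚ) := by
    rw [hc]; push_cast; rw [← h1]; ring
  exact ⟨c * a, by exact_mod_cast congrArg (Rat.cast : ℚ → ℝ) h2⟩

theorem facetWeight_ne_zero {w : Fin n → ℚ} (hw : w ∈ P.weights) (i : Fin n) :
    P.facetWeight w i ≠ 0 := by
  have h1 : (0 : ℝ) < P.N := by exact_mod_cast P.N_pos
  have h2 : (0 : ℝ) < w i := by exact_mod_cast P.pos w hw i
  have h3 := P.facetWeight_cast hw i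
  intro h
  rw [h, Nat.cast_zero] at h3
  exact (mul_pos h1 h2).ne h3

/-- Real vectors are allowed because derivations involve the points α - e_i, which may have a
negative entry. -/
theorem le_wt_iff {c : ℝ} {r : Fin n → ℝ} :
    c ≤ P.wt r ↔ ∀ w ∈ P.weights, c ≤ ∑ i, (P.facetWeight w i : ℝ) * r i := by
  have h1 : (0 : ℝ) < P.N := by exact_mod_cast P.N_pos
  rw [wt, ← div_le_iff₀' h1, lam, Finset.le_inf'_iff]
  refine forall₂_congr fun w hw => ?_
  rw [div_le_iff₀' h1, Finset.mul_sum]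
  simp only [P.facetWeight_cast hw, mul_assoc]

theorem weight_cast (m : Fin n → ℕ) (α : Fin n →₀ ℕ) :
    ((weight m α : ℕ) : ℝ) = ∑ i, (m i : ℝ) * point α i := by
  rw [weight_eq_sum]
  push_cast
  exact Finset.sum_congr rfl fun i _ => by rw [point, smul_eq_mul]; push_cast; ring

theorem le_deg_iff {k : ℕ} {α : Fin n →₀ ℕ} :
    k ≤ P.deg α ↔ ∀ w ∈ P.weights, k ≤ weight (P.facetWeight w) α := by
  rw [← Nat.cast_le (α := ℝ), deg_eq_wt, le_wt_iff]
  refine forall₂_congr fun w _ => ?_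
  rw [← weight_cast, Nat.cast_le]

/-- The facet weights are positive integers. Hence truncation by total degree controls the
valuation, and each level contains finitely many monomials. -/
theorem degree_le_deg (α : Fin n →₀ ℕ) : α.degree ≤ P.deg α := by
  rw [le_deg_iff]
  intro w hw
  rw [weight_eq_sum, degree_eq_sum]
  exact Finset.sum_le_sum fun i _ => Nat.le_mul_of_pos_right _
    (Nat.pos_of_ne_zero (P.facetWeight_ne_zero hw i))

theorem finite_deg_lt (k : ℕ) : {α : Fin n →₀ ℕ | P.deg α < k}.Finite :=
  (finite_of_degree_lt k).subset fun α hα => lt_of_le_of_lt (P.degree_le_deg α) hα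

theorem natCast_le_wt_iff {k : ℕ} {α : Fin n →₀ ℕ} :
    (k : EReal) ≤ ((P.wt (point α) : ℝ) : EReal) ↔ k ≤ P.deg α := by
  rw [← deg_eq_wt]
  norm_cast

theorem mem_filt_iff {k : ℕ} {f : MvPowerSeries (Fin n) K} :
    f ∈ P.filt K k ↔ f ∈ suppGE K P.deg k := by
  rw [mem_suppGE']
  change (k : EReal) ≤ P.val f ↔ _
  simp only [val, le_iInf_iff, natCast_le_wt_iff]

theorem mem_suppGE_deg_iff {k : ℕ} {f : MvPowerSeries (Fin n) K} :
    f ∈ suppGE K P.deg k ↔ ∀ w ∈ P.weights, f ∈ suppGE K (weight (P.facetWeight w)) k := by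
  simp only [mem_suppGE', le_deg_iff]
  exact ⟨fun h w hw α hα => h α hα w hw, fun h α hα w hw => h w hw α hα⟩

theorem mul_mem_suppGE_deg {k l : ℕ} {f g : MvPowerSeries (Fin n) K}
    (hf : f ∈ suppGE K P.deg k) (hg : g ∈ suppGE K P.deg l) : f * g ∈ suppGE K P.deg (k + l) := by
  rw [mem_suppGE_deg_iff] at *
  exact fun w hw => mul_mem_suppGE_weight (hf w hw) (hg w hw)

theorem mul_mem_suppGE_deg_left {k : ℕ} {f g : MvPowerSeries (Fin n) K}
    (hf : f ∈ suppGE K P.deg k) : f * g ∈ suppGE K P.deg k :=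
  P.mul_mem_suppGE_deg (l := 0) hf (by rw [suppGE_zero]; trivial)

/-- The valuation of `ξ` is a minimum over the facets, so one bound on it holds for each facet
weight separately; this is the form in which substitutions can be estimated. -/
theorem exists_of_mem_tjAC {f h : MvPowerSeries (Fin n) K} {d D : ℕ} (hval : P.val f = d)
    (hD : d ≤ D) (hh : h ∈ P.tjAC f D) :
    ∃ (g : MvPowerSeries (Fin n) K)
      (ξ : Derivation K (MvPowerSeries (Fin n) K) (MvPowerSeries (Fin n) K)),
      h = g * f + ξ f ∧ g ∈ suppGE K P.deg (D - d) ∧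
        ∀ w ∈ P.weights, ∀ i,
          ξ (X i) ∈ suppGE K (weight (P.facetWeight w)) (P.facetWeight w i + (D - d)) := by
  obtain ⟨g, ξ, rfl, hmin⟩ := hh
  rw [hval, le_min_iff] at hmin
  have aux : ∀ (x : EReal) (r : ℝ), (D : EReal) ≤ x + d → x ≤ r → (D : ℝ) ≤ r + d := by
    intro x r h1 h2
    have := h1.trans (add_le_add_left h2 _)
    exact_mod_cast this
  refine ⟨g, ξ, rfl, ?_, fun w hw i => ?_⟩
  · rw [mem_suppGE']
    intro α hα
    have := aux _ _ hmin.1 (iInf₂_le α hα)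
    rw [← deg_eq_wt] at this
    have : D ≤ P.deg α + d := by exact_mod_cast this
    omega
  · rw [mem_suppGE']
    intro α hα
    have h1 := aux _ _ hmin.2 ((iInf_le _ i).trans (iInf₂_le α hα))
    have h2 := P.le_wt_iff.1 (sub_le_iff_le_add.2 h1) w hw
    simp only [Pi.sub_apply, mul_sub, Finset.sum_sub_distrib, ← weight_cast] at h2
    rw [Finset.sum_eq_single i (fun j _ hne => by rw [Pi.single_eq_of_ne hne, mul_zero])
      (by simp), Pi.single_eq_same, mul_one] at h2
    have h3 : (P.facetWeight w i : ℝ) + D ≤ (weight (P.facetWeight w) α : ℕ) + d := by linarith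
    have h4 : P.facetWeight w i + D ≤ weight (P.facetWeight w) α + d := by exact_mod_cast h3
    omega

end CPolytope

/-! ### Contact transformations and their infinite compositions -/

theorem ContactEquiv.symm {n : ℕ} {K : Type*} [Field K] {f g : MvPowerSeries (Fin n) K}
    (h : ContactEquiv f g) : ContactEquiv g f := by
  obtain ⟨φ, u, rfl⟩ := h
  refine ⟨φ.symm, (Units.map (φ.symm : _ →* _) u)⁻¹, ?_⟩
  rw [map_mul, Units.eq_inv_mul_iff_mul_eq]
  simp

namespace CPolytope

open MvPowerSeries Finsupp

variable {n : ℕ} {K : Type*} [Field K] (P : CPolytope n)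

theorem zero_mem_suppGE_deg_zero (f : MvPowerSeries (Fin n) K) : f ∈ suppGE K P.deg 0 := by
  rw [suppGE_zero]; trivial

/-- An endomorphism raising the filtration when the identity is subtracted is an automorphism. -/
theorem bijective_of_sub_mem (Φ : MvPowerSeries (Fin n) K →ₐ[K] MvPowerSeries (Fin n) K)
    (h : ∀ k, ∀ f ∈ suppGE K P.deg k, Φ f - f ∈ suppGE K P.deg (k + 1)) :
    Function.Bijective Φ := by
  have hmem : ∀ k, ∀ f ∈ suppGE K P.deg k, Φ f ∈ suppGE K P.deg k := fun k f hf => by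
    have := add_mem (suppGE_anti (Nat.le_succ k) (h k f hf)) hf
    rwa [sub_add_cancel] at this
  constructor
  · rw [injective_iff_map_eq_zero]
    intro f hf
    refine eq_zero_of_forall_mem_suppGE (v := P.deg) fun k => ?_
    induction k with
    | zero => exact P.zero_mem_suppGE_deg_zero f
    | succ k ih =>
      have := h k f ih
      rwa [hf, zero_sub, neg_mem_iff] at this
  · intro g
    -- Adding the residual r = g - Φ x to x leaves the new residual r - Φ r, which lies one level
    -- higher.
    let s : ℕ → MvPowerSeries (Fin n) K := fun j => Nat.rec 0 (fun _ x => x + (g - Φ x)) j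
    have hs : ∀ j, s (j + 1) = s j + (g - Φ (s j)) := fun j => rfl
    have hg : ∀ j, g - Φ (s j) ∈ suppGE K P.deg j := by
      intro j
      induction j with
      | zero => exact P.zero_mem_suppGE_deg_zero _
      | succ j ih =>
        have := neg_mem (h j _ ih)
        rw [neg_sub] at this
        rwa [hs, map_add, ← sub_sub]
    obtain ⟨x, hx⟩ := exists_limit (v := P.deg) s fun j => by
      rw [hs, add_sub_cancel_left]; exact hg j
    refine ⟨x, ?_⟩
    rw [← sub_eq_zero]
    refine eq_zero_of_forall_mem_suppGE (v := P.deg) fun j => ?_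
    have := sub_mem (hmem j _ (hx j)) (hg j)
    rw [map_sub] at this
    convert this using 1
    ring

/-- Pointwise limits of algebra endomorphisms are algebra endomorphisms. -/
theorem exists_algHom_limit (Φ : ℕ → MvPowerSeries (Fin n) K →ₐ[K] MvPowerSeries (Fin n) K)
    (h : ∀ j f, Φ (j + 1) f - Φ j f ∈ suppGE K P.deg j) :
    ∃ Ψ : MvPowerSeries (Fin n) K →ₐ[K] MvPowerSeries (Fin n) K,
      ∀ j f, Ψ f - Φ j f ∈ suppGE K P.deg j := by
  choose L hL using fun f => exists_limit (v := P.deg) (fun j => Φ j f) fun j => h j f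
  -- Limits are unique, so each algebra law for `L` only needs the expected value to be a limit as
  -- well.
  have huniq : ∀ f g, (∀ j, g - Φ j f ∈ suppGE K P.deg j) → L f = g := by
    intro f g hg
    rw [← sub_eq_zero]
    refine eq_zero_of_forall_mem_suppGE (v := P.deg) fun j => ?_
    have := sub_mem (hL f j) (hg j)
    rwa [sub_sub_sub_cancel_right] at this
  refine ⟨
    { toFun := L
      map_one' := ?_
      map_mul' := ?_
      map_zero' := ?_
      map_add' := ?_
      commutes' := ?_ }, fun j f => hL f j⟩
  · exact huniq _ _ fun j => by rw [map_one, sub_self]; exact zero_mem _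
  · intro f g
    refine huniq _ _ fun j => ?_
    have h1 := P.mul_mem_suppGE_deg_left (g := L g) (hL f j)
    have h2 := P.mul_mem_suppGE_deg_left (g := Φ j f) (hL g j)
    convert add_mem h1 h2 using 1
    rw [map_mul]; ring
  · exact huniq _ _ fun j => by rw [map_zero, sub_self]; exact zero_mem _
  · intro f g
    refine huniq _ _ fun j => ?_
    convert add_mem (hL f j) (hL g j) using 1
    rw [map_add]; ring
  · intro c
    exact huniq _ _ fun j => by rw [AlgHom.commutes, sub_self]; exact zero_mem _

/-- An infinite composition of contact transformations which converge to the identity is a contact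
transformation. -/
theorem contactEquiv_of_limit (p : ℕ → MvPowerSeries (Fin n) K) (q : MvPowerSeries (Fin n) K)
    (φ : ℕ → MvPowerSeries (Fin n) K →ₐ[K] MvPowerSeries (Fin n) K)
    (u : ℕ → MvPowerSeries (Fin n) K) (hp : ∀ j, p (j + 1) = u j * φ j (p j))
    (hφ : ∀ j k, ∀ f ∈ suppGE K P.deg k, φ j f - f ∈ suppGE K P.deg (k + j + 1))
    (hu : ∀ j, u j - 1 ∈ suppGE K P.deg (j + 1)) (hq : ∀ j, p j - q ∈ suppGE K P.deg j) :
    ContactEquiv (p 0) q := by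
  let Φ : ℕ → MvPowerSeries (Fin n) K →ₐ[K] MvPowerSeries (Fin n) K :=
    fun j => Nat.rec (AlgHom.id K _) (fun j ψ => (φ j).comp ψ) j
  have hΦ : ∀ j f, Φ (j + 1) f = φ j (Φ j f) := fun j f => rfl
  -- Later automorphisms also act on the earlier units; this recursion makes `p j = U j * Φ j (p
  -- 0)`.
  let U : ℕ → MvPowerSeries (Fin n) K := fun j => Nat.rec 1 (fun j x => u j * φ j x) j
  have hU : ∀ j, U (j + 1) = u j * φ j (U j) := fun j => rfl
  have hpU : ∀ j, p j = U j * Φ j (p 0) := by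
    intro j
    induction j with
    | zero => exact (one_mul _).symm
    | succ j ih => rw [hp, ih, map_mul, hU, hΦ, mul_assoc]
  have hΦid : ∀ k, ∀ f ∈ suppGE K P.deg k, ∀ j, Φ j f - f ∈ suppGE K P.deg (k + 1) := by
    intro k f hf j
    induction j with
    | zero => rw [show Φ 0 f = f from rfl, sub_self]; exact zero_mem _
    | succ j ih =>
      have h1 : Φ j f ∈ suppGE K P.deg k := by
        have := add_mem (suppGE_anti (Nat.le_succ k) ih) hf
        rwa [sub_add_cancel] at this
      rw [hΦ, ← sub_add_sub_cancel _ (Φ j f)]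
      exact add_mem (suppGE_anti (by omega) (hφ j k _ h1)) ih
  have hUstep : ∀ j, U (j + 1) - U j ∈ suppGE K P.deg (j + 1) := by
    intro j
    have h1 := P.mul_mem_suppGE_deg_left (g := φ j (U j)) (hu j)
    have h2 := hφ j 0 (U j) (P.zero_mem_suppGE_deg_zero _)
    convert add_mem h1 (suppGE_anti (by omega) h2) using 1
    rw [hU]; ring
  obtain ⟨Ψ, hΨ⟩ := P.exists_algHom_limit Φ fun j f => by
    rw [hΦ]
    exact suppGE_anti (by omega) (hφ j 0 _ (P.zero_mem_suppGE_deg_zero _))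
  obtain ⟨V, hV⟩ := exists_limit (v := P.deg) U fun j => suppGE_anti (by omega) (hUstep j)
  have hbij : Function.Bijective Ψ := P.bijective_of_sub_mem Ψ fun k f hf => by
    rw [← sub_add_sub_cancel _ (Φ (k + 1) f)]
    exact add_mem (hΨ _ _) (hΦid k f hf (k + 1))
  have hunit : IsUnit V := by
    have h1 := add_mem (hV 1) (hUstep 0)
    rw [zero_add, sub_add_sub_cancel] at h1
    have h2 := h1 0 (by
      rw [show P.deg 0 = 0 by simp [deg, wt, lam, point]]; exact Nat.one_pos)
    rw [map_sub, sub_eq_zero, coeff_zero_eq_constantCoeff_apply,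
      coeff_zero_eq_constantCoeff_apply] at h2
    rw [isUnit_iff_constantCoeff, h2]
    exact isUnit_one.map _
  refine ContactEquiv.symm ⟨AlgEquiv.ofBijective Ψ hbij, hunit.unit, ?_⟩
  rw [IsUnit.unit_spec, AlgEquiv.coe_ofBijective, ← sub_eq_zero]
  refine eq_zero_of_forall_mem_suppGE (v := P.deg) fun j => ?_
  have h1 := P.mul_mem_suppGE_deg_left (g := Ψ (p 0)) (hV j)
  have h2 := P.mul_mem_suppGE_deg_left (g := U j) (hΨ j (p 0))
  convert neg_mem (add_mem (add_mem h1 h2) (hq j)) using 1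
  rw [hpU j]; ring

/-- Removing an element of `tj_P^{AC}(f₀)_D` from a power series with principal part `f₀`, up to
terms of valuation larger than `D`. -/
theorem exists_contact_step {f₀ p h : MvPowerSeries (Fin n) K} {d D : ℕ} (hval : P.val f₀ = d)
    (hf₀ : f₀ ∈ suppGE K P.deg d) (hp : p - f₀ ∈ suppGE K P.deg (d + 1)) (hD : d < D)
    (hh : h ∈ P.tjAC f₀ D) :
    ∃ (φ : MvPowerSeries (Fin n) K →ₐ[K] MvPowerSeries (Fin n) K) (u : MvPowerSeries (Fin n) K),
      (∀ k, ∀ f ∈ suppGE K P.deg k, φ f - f ∈ suppGE K P.deg (k + (D - d))) ∧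
        u - 1 ∈ suppGE K P.deg (D - d) ∧ u * φ p - (p - h) ∈ suppGE K P.deg (D + 1) := by
  obtain ⟨g, ξ, rfl, hg, hξ⟩ := P.exists_of_mem_tjAC hval hD.le hh
  set e := D - d with he
  have hξ' : ∀ w ∈ P.weights, ∀ i,
      (-ξ) (X i) ∈ suppGE K (weight (P.facetWeight w)) (P.facetWeight w i + e) :=
    fun w hw i => by rw [Derivation.neg_apply]; exact neg_mem (hξ w hw i)
  have hs : HasSubst (fun i => X i + (-ξ) (X i) : Fin n → MvPowerSeries (Fin n) K) := by
    refine hasSubst_of_constantCoeff_zero fun i => ?_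
    obtain ⟨w, hw⟩ := P.nonempty
    rw [map_add, constantCoeff_X, zero_add, ← coeff_zero_eq_constantCoeff_apply]
    refine hξ' w hw i 0 ?_
    rw [map_zero]
    exact Nat.add_pos_left (Nat.pos_of_ne_zero (P.facetWeight_ne_zero hw i)) _
  have hsub : ∀ k, ∀ f ∈ suppGE K P.deg k,
      substAlgHom (R := K) hs f - f - (-ξ) f ∈ suppGE K P.deg (k + 2 * e) := by
    intro k f hf
    rw [mem_suppGE_deg_iff] at hf ⊢
    exact fun w hw => substAlgHom_sub_mem_suppGE_weight hs (P.facetWeight_ne_zero hw) (-ξ)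
      (hξ' w hw) (fun i => rfl) (hf w hw)
  have hder : ∀ k, ∀ f ∈ suppGE K P.deg k, ξ f ∈ suppGE K P.deg (k + e) := by
    intro k f hf
    rw [mem_suppGE_deg_iff] at hf ⊢
    exact fun w hw => derivation_mem_suppGE_weight ξ (hξ w hw) (hf w hw)
  have hpd : p ∈ suppGE K P.deg d := by
    have := add_mem (suppGE_anti (Nat.le_succ d) hp) hf₀
    rwa [sub_add_cancel] at this
  -- To first order, substitution by x_i - ξ(x_i) subtracts `ξ p` and the factor `1 - g` subtracts
  -- `g * p`.
  refine ⟨substAlgHom (R := K) hs, 1 - g, fun k f hf => ?_, ?_, ?_⟩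
  · have := sub_mem (suppGE_anti (by omega) (hsub k f hf)) (hder k f hf)
    rwa [Derivation.neg_apply, sub_neg_eq_add, add_sub_cancel_right] at this
  · rw [sub_sub_cancel_left]; exact neg_mem hg
  -- The errors are the second order part of the substitution, `ξ` and `g` applied to `p - f₀`, and
  -- the mixed term `g * ξ p`; `e ≥ 1` puts all of them above `D`.
  · have h1 := P.mul_mem_suppGE_deg_left (g := 1 - g)
      (suppGE_anti (show D + 1 ≤ d + 2 * e by omega) (hsub d p hpd))
    have h2 := suppGE_anti (show D + 1 ≤ d + 1 + e by omega) (hder _ _ hp)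
    have h3 := suppGE_anti (show D + 1 ≤ e + (d + 1) by omega) (P.mul_mem_suppGE_deg hg hp)
    have h4 := suppGE_anti (show D + 1 ≤ e + (d + e) by omega)
      (P.mul_mem_suppGE_deg hg (hder _ _ hpd))
    convert add_mem (sub_mem (sub_mem h1 h2) h3) h4 using 1
    rw [Derivation.neg_apply, map_sub]; ring

/-- If all power series of valuation at least `D₁ > d` can be reduced modulo the tangent spaces
`tj_P^{AC}(f₀)_D` to power series with exponents in `S`, then each power series that agrees with `q`
up to valuation `D₁` is contact equivalent to `q` plus a series with exponents in `S`. -/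
theorem exists_contactEquiv_add {f₀ p q : MvPowerSeries (Fin n) K} {d D₁ : ℕ}
    (S : Set (Fin n →₀ ℕ)) (hval : P.val f₀ = d) (hf₀ : f₀ ∈ suppGE K P.deg d) (hD₁ : d < D₁)
    (hred : ∀ D, D₁ ≤ D → ∀ h ∈ suppGE K P.deg D, ∃ μ ∈ suppGE K P.deg D, ∃ t ∈ P.tjAC f₀ D,
      (∀ α, coeff α μ ≠ 0 → α ∈ S) ∧ h - μ - t ∈ suppGE K P.deg (D + 1))
    (hq : q - f₀ ∈ suppGE K P.deg (d + 1)) (hpq : p - q ∈ suppGE K P.deg D₁) :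
    ∃ ν : MvPowerSeries (Fin n) K, (∀ α, coeff α ν ≠ 0 → α ∈ S) ∧ ContactEquiv p (q + ν) := by
  -- A state is the current series together with the part in `S` collected so far. `Good` is assumed
  -- inside the existential below, so that the chosen steps are total functions.
  let Good : ℕ → MvPowerSeries (Fin n) K × MvPowerSeries (Fin n) K → Prop := fun j s =>
    (∀ α, coeff α s.2 ≠ 0 → α ∈ S) ∧ s.2 ∈ suppGE K P.deg D₁ ∧
      s.1 - q - s.2 ∈ suppGE K P.deg (D₁ + j)
  have hstep : ∀ (j : ℕ) (s : MvPowerSeries (Fin n) K × MvPowerSeries (Fin n) K),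
      ∃ (φ : MvPowerSeries (Fin n) K →ₐ[K] MvPowerSeries (Fin n) K)
        (u μ : MvPowerSeries (Fin n) K), Good j s →
        Good (j + 1) (u * φ s.1, s.2 + μ) ∧ μ ∈ suppGE K P.deg j ∧
          (∀ k, ∀ f ∈ suppGE K P.deg k, φ f - f ∈ suppGE K P.deg (k + j + 1)) ∧
            u - 1 ∈ suppGE K P.deg (j + 1) := by
    rintro j ⟨p, ν⟩
    by_cases hG : Good j (p, ν)
    · obtain ⟨hS, hν, hpν⟩ := hG
      obtain ⟨μ, hμ, t, ht, hμS, hr⟩ := hred (D₁ + j) (by omega) _ hpν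
      have hpf : p - f₀ ∈ suppGE K P.deg (d + 1) := by
        convert add_mem (add_mem (suppGE_anti (by omega) hpν)
          (suppGE_anti hD₁ hν)) hq using 1
        ring
      obtain ⟨φ, u, hφ, hu, hup⟩ := P.exists_contact_step hval hf₀ hpf (by omega) ht
      refine ⟨φ, u, μ, fun _ => ⟨⟨fun α hα => ?_, ?_, ?_⟩, ?_, ?_, ?_⟩⟩
      · by_cases h : coeff α μ = 0
        · refine hS α ?_
          rwa [map_add, h, add_zero] at hα
        · exact hμS α h
      · exact add_mem hν (suppGE_anti (by omega) hμ)
      · have := add_mem hup hr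
        rwa [show u * φ p - (p - t) + (p - q - ν - μ - t) = u * φ p - q - (ν + μ) by ring] at this
      · exact suppGE_anti (by omega) hμ
      · exact fun k f hf => suppGE_anti (by omega) (hφ k f hf)
      · exact suppGE_anti (by omega) hu
    · exact ⟨AlgHom.id K _, 0, 0, fun h => absurd h hG⟩
  choose φ u μ H using hstep
  let s : ℕ → MvPowerSeries (Fin n) K × MvPowerSeries (Fin n) K := fun j =>
    Nat.rec (p, 0) (fun j s => (u j s * φ j s s.1, s.2 + μ j s)) j
  have hs : ∀ j, s (j + 1) = (u j (s j) * φ j (s j) (s j).1, (s j).2 + μ j (s j)) := fun j => rfl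
  have hgood : ∀ j, Good j (s j) := by
    intro j
    induction j with
    | zero =>
      refine ⟨fun α h => absurd (map_zero _) h, zero_mem _, ?_⟩
      change p - q - 0 ∈ _
      rwa [sub_zero]
    | succ j ih => exact (H j (s j) ih).1
  obtain ⟨ν, hν⟩ := exists_limit (v := P.deg) (fun j => (s j).2) fun j => by
    rw [hs, add_sub_cancel_left]; exact (H j (s j) (hgood j)).2.1
  refine ⟨ν, fun α hα => (hgood (P.deg α + 1)).1 α ?_, ?_⟩
  · have := hν (P.deg α + 1) α (Nat.lt_succ_self _)
    rw [map_sub, sub_eq_zero] at this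
    rwa [← this]
  · refine P.contactEquiv_of_limit (fun j => (s j).1) _ (fun j => φ j (s j)) (fun j => u j (s j))
      (fun j => rfl) (fun j => (H j (s j) (hgood j)).2.2.1) (fun j => (H j (s j) (hgood j)).2.2.2)
      fun j => ?_
    convert sub_mem (suppGE_anti (by omega) (hgood j).2.2) (hν j) using 1
    ring

end CPolytope

/-- A finite direct sum of modules over a field indexed by `ℕ` is eventually zero. -/
theorem DirectSum.exists_forall_eq_zero_of_finite {K : Type*} [Field K] (M : ℕ → Type*)
    [∀ d, AddCommGroup (M d)] [∀ d, Module K (M d)] [FiniteDimensional K (DirectSum ℕ M)] :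
    ∃ D₀, ∀ D, D₀ ≤ D → ∀ x : M D, x = 0 := by
  classical
  obtain ⟨s, hs⟩ := Module.Finite.fg_top (R := K) (M := DirectSum ℕ M)
  refine ⟨(s.sup fun x => DFinsupp.support x).sup id + 1, fun D hD x => ?_⟩
  have hle : (⊤ : Submodule K (DirectSum ℕ M)) ≤ LinearMap.ker (DirectSum.component K ℕ M D) := by
    rw [← hs, Submodule.span_le]
    intro y hy
    change y D = 0
    by_contra hne
    have h1 : D ∈ s.sup fun x => DFinsupp.support x :=
      Finset.mem_sup.2 ⟨y, hy, DFinsupp.mem_support_iff.2 hne⟩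
    have h2 : D ≤ (s.sup fun x => DFinsupp.support x).sup id := Finset.le_sup (f := id) h1
    omega
  have := hle (x := DirectSum.lof K ℕ M D x) trivial
  rwa [LinearMap.mem_ker, DirectSum.component.lof_self] at this

/-! ### Initial forms, graded pieces and regular bases -/

namespace CPolytope

open MvPowerSeries Finsupp

variable {n : ℕ} {K : Type*} [Field K] (P : CPolytope n)

theorem lam_le_lam_iff {α β : Fin n →₀ ℕ} :
    P.lam (point α) ≤ P.lam (point β) ↔ P.deg α ≤ P.deg β := by
  have h1 : (0 : ℝ) < P.N := by exact_mod_cast P.N_pos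
  rw [← Nat.cast_le (α := ℝ), deg_eq_wt, deg_eq_wt, wt, wt, mul_le_mul_iff_right₀ h1]

section initialForm

variable {f : MvPowerSeries (Fin n) K} {α : Fin n →₀ ℕ}

theorem coeff_initialForm_of_forall_le (h : ∀ β, coeff β f ≠ 0 → P.deg α ≤ P.deg β) :
    coeff α (P.initialForm f) = coeff α f :=
  if_pos fun β hβ => P.lam_le_lam_iff.2 (h β hβ)

theorem coeff_initialForm_of_lt {β : Fin n →₀ ℕ} (hβ : coeff β f ≠ 0) (h : P.deg β < P.deg α) :
    coeff α (P.initialForm f) = 0 :=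
  if_neg fun h' => absurd (P.lam_le_lam_iff.1 (h' β hβ)) (not_le.2 h)

theorem initialForm_spec (hf : f ≠ 0) :
    ∃ d : ℕ, P.val (P.initialForm f) = d ∧ P.initialForm f ∈ suppGE K P.deg d ∧
      f - P.initialForm f ∈ suppGE K P.deg (d + 1) := by
  classical
  have hex : ∃ k, ∃ α, coeff α f ≠ 0 ∧ P.deg α = k := by
    by_contra! h
    exact hf (MvPowerSeries.ext fun α => by
      by_contra hα
      exact h _ α hα rfl)
  obtain ⟨α, hα, hdeg⟩ := Nat.find_spec hex
  set d := Nat.find hex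
  have hmin : ∀ β, coeff β f ≠ 0 → d ≤ P.deg β := fun β hβ => Nat.find_min' hex ⟨β, hβ, rfl⟩
  have hcoeff : ∀ β, coeff β (P.initialForm f) ≠ 0 → P.deg β = d := by
    intro β hβ
    refine le_antisymm ?_ ?_
    · by_contra! h
      exact hβ (P.coeff_initialForm_of_lt hα (by omega))
    · by_contra! h
      have h0 : coeff β f = 0 := by
        by_contra h'
        exact absurd (hmin β h') (by omega)
      rw [P.coeff_initialForm_of_forall_le fun γ hγ => by have := hmin γ hγ; omega] at hβ
      exact hβ h0
  have hαd : ∀ β, P.deg β ≤ d → coeff β (P.initialForm f) = coeff β f := fun β hβ =>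
    P.coeff_initialForm_of_forall_le fun γ hγ => hβ.trans (hmin γ hγ)
  have hmem : P.initialForm f ∈ suppGE K P.deg d :=
    mem_suppGE'.2 fun β hβ => (hcoeff β hβ).ge
  refine ⟨d, le_antisymm ?_ ?_, hmem, fun β hβ => ?_⟩
  · refine (iInf₂_le α (by rwa [hαd α hdeg.le])).trans ?_
    rw [← deg_eq_wt, hdeg]
    norm_cast
  · exact P.mem_filt_iff.2 hmem
  · rw [map_sub, hαd β (by omega), sub_self]

end initialForm

section graded

variable {f : MvPowerSeries (Fin n) K} {D : ℕ}

theorem exists_of_grMk_eq_zero {h : P.filt K D} (hh : P.grMk f D h = 0) :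
    ∃ t ∈ P.tjAC f D, (h : MvPowerSeries (Fin n) K) - t ∈ suppGE K P.deg (D + 1) := by
  have h1 : (h : MvPowerSeries (Fin n) K) ∈ P.tjAC f D ⊔ P.filt K (D + 1) :=
    (Submodule.Quotient.mk_eq_zero ((P.tjAC f D ⊔ P.filt K (D + 1)).submoduleOf _)).1 hh
  obtain ⟨t, ht, r, hr, hsum⟩ := Submodule.mem_sup.1 h1
  refine ⟨t, ht, ?_⟩
  rw [← hsum, add_sub_cancel_left]
  exact P.mem_filt_iff.1 hr

theorem grMk_eq_zero_of_mem {h : P.filt K D}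
    (hh : (h : MvPowerSeries (Fin n) K) ∈ suppGE K P.deg (D + 1)) : P.grMk f D h = 0 :=
  (Submodule.Quotient.mk_eq_zero _).2
    (Submodule.mem_sup_right (P.mem_filt_iff.2 hh) :
      (h : MvPowerSeries (Fin n) K) ∈ P.tjAC f D ⊔ P.filt K (D + 1))

/-- Finite dimension leaves only finitely many nonzero graded pieces, and a vanishing piece is this
approximation property. -/
theorem AAC.exists_forall_mem_tjAC {P : CPolytope n} (hf : P.AAC f) :
    ∃ D₀, ∀ D, D₀ ≤ D → ∀ h ∈ suppGE K P.deg D,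
      ∃ t ∈ P.tjAC f D, h - t ∈ suppGE K P.deg (D + 1) := by
  have : FiniteDimensional K (P.grAC f) := hf
  obtain ⟨D₀, h0⟩ := DirectSum.exists_forall_eq_zero_of_finite (K := K) (fun d => P.grPiece f d)
  exact ⟨D₀, fun D hD h hh =>
    P.exists_of_grMk_eq_zero (h := ⟨h, P.mem_filt_iff.2 hh⟩) (h0 D hD _)⟩

/-- For the zero series the tangent spaces vanish, so the filtration would be constant from some
level on, and a monomial of high degree would lie in all levels. -/
theorem AAC.ne_zero {P : CPolytope n} (hn : 1 ≤ n) (hf : P.AAC f) : f ≠ 0 := by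
  rintro rfl
  obtain ⟨D₀, h0⟩ := hf.exists_forall_mem_tjAC
  have h1 : ∀ D, D₀ ≤ D → ∀ h ∈ suppGE K P.deg D, h ∈ suppGE K P.deg (D + 1) := by
    intro D hD h hh
    obtain ⟨t, ⟨g, ξ, rfl, -⟩, ht⟩ := h0 D hD h hh
    simpa using ht
  let α : Fin n →₀ ℕ := single ⟨0, hn⟩ D₀
  have hα : D₀ ≤ P.deg α := by
    have := P.degree_le_deg α
    rwa [degree_single] at this
  have h2 : ∀ j, (monomial α 1 : MvPowerSeries (Fin n) K) ∈ suppGE K P.deg (D₀ + j) := by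
    intro j
    induction j with
    | zero => exact monomial_mem_suppGE α 1 hα
    | succ j ih => exact h1 (D₀ + j) (Nat.le_add_right _ _) _ ih
  have h3 : (monomial α 1 : MvPowerSeries (Fin n) K) = 0 :=
    eq_zero_of_forall_mem_suppGE (v := P.deg) fun k =>
      suppGE_anti (Nat.le_add_left k D₀) (h2 k)
  have h4 := congrArg (coeff α) h3
  rw [coeff_monomial_same, map_zero] at h4
  exact one_ne_zero h4

theorem span_range_grMonomial (f : MvPowerSeries (Fin n) K) :
    Submodule.span K (Set.range (P.grMonomial f)) = ⊤ := by
  classical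
  rw [eq_top_iff]
  rintro x -
  induction x using DirectSum.induction_on with
  | zero => exact zero_mem _
  | add x y hx hy => exact add_mem hx hy
  | of D y =>
    obtain ⟨h, rfl⟩ : ∃ h, P.grMk f D h = y := Submodule.mkQ_surjective _ y
    -- The default 0 is harmless: monomials below level `D` have coefficient zero in `h`.
    let m : (Fin n →₀ ℕ) → P.filt K D := fun α =>
      if hα : D ≤ P.deg α then
        ⟨monomial α 1, P.mem_filt_iff.2 (monomial_mem_suppGE α 1 hα)⟩ else 0
    have hm : ∀ α, D ≤ P.deg α → (m α : MvPowerSeries (Fin n) K) = monomial α 1 := fun α hα => by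
      simp only [m, dif_pos hα]
    let s := (P.finite_deg_lt (D + 1)).toFinset
    have hcoeff : ∀ α, P.deg α < D → coeff α (h : MvPowerSeries (Fin n) K) = 0 :=
      P.mem_filt_iff.1 h.2
    have hY : ((∑ α ∈ s, coeff α (h : MvPowerSeries (Fin n) K) • m α : P.filt K D) :
        MvPowerSeries (Fin n) K) = ∑ α ∈ s, monomial α (coeff α (h : MvPowerSeries (Fin n) K)) := by
      rw [Submodule.coe_sum]
      refine Finset.sum_congr rfl fun α _ => ?_
      by_cases hα : P.deg α < D
      · rw [hcoeff α hα, zero_smul, map_zero]; rfl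
      · change coeff α (h : MvPowerSeries (Fin n) K) • (m α : MvPowerSeries (Fin n) K) = _
        rw [hm α (by omega), ← map_smul, smul_eq_mul, mul_one]
    have hzero : P.grMk f D (h - ∑ α ∈ s, coeff α (h : MvPowerSeries (Fin n) K) • m α) = 0 := by
      refine P.grMk_eq_zero_of_mem ?_
      rw [Submodule.coe_sub, hY]
      exact sub_sum_monomial_mem_suppGE _ _
    rw [map_sub, sub_eq_zero, map_sum] at hzero
    change DirectSum.lof K ℕ (fun d => P.grPiece f d) D _ ∈ _
    rw [hzero, map_sum]
    refine sum_mem fun α hα => ?_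
    rw [map_smul, map_smul]
    by_cases hαD : P.deg α < D
    · rw [hcoeff α hαD, zero_smul]; exact zero_mem _
    · have hlt : P.deg α < D + 1 := (P.finite_deg_lt (D + 1)).mem_toFinset.1 hα
      obtain rfl : P.deg α = D := by omega
      refine Submodule.smul_mem _ _ (Submodule.subset_span ⟨α, ?_⟩)
      rw [grMonomial]
      congr 2
      exact Subtype.ext (hm α le_rfl).symm

theorem exists_isRegularBasis (hf : P.AAC f) :
    ∃ Λ : Finset (Fin n →₀ ℕ), P.IsRegularBasis f (Λ : Set (Fin n →₀ ℕ)) := by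
  have : FiniteDimensional K (P.grAC f) := hf
  obtain ⟨κ, a, ha, hspan, hli⟩ := exists_linearIndependent' K (P.grMonomial f)
  have : Finite κ := hli.finite
  refine ⟨(Set.finite_range a).toFinset, ?_⟩
  rw [Set.Finite.coe_toFinset]
  refine ⟨?_, ?_⟩
  · rw [← linearIndependent_equiv (Equiv.ofInjective a ha)]
    exact hli
  · rw [← Set.range_comp, hspan, P.span_range_grMonomial]

theorem IsRegularBasis.finite {P : CPolytope n} {Λ : Set (Fin n →₀ ℕ)} (hΛ : P.IsRegularBasis f Λ)
    (hf : P.AAC f) : Λ.Finite := by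
  have : FiniteDimensional K (P.grAC f) := hf
  exact hΛ.1.finite

/-- The classes of monomials are homogeneous, so projecting a spanning relation to degree `D`
retains only basis monomials of degree exactly `D`. -/
theorem IsRegularBasis.exists_sub_mem {P : CPolytope n} {Λ : Set (Fin n →₀ ℕ)}
    (hΛ : P.IsRegularBasis f Λ) {h : MvPowerSeries (Fin n) K} (hh : h ∈ suppGE K P.deg D) :
    ∃ μ ∈ suppGE K P.deg D, ∃ t ∈ P.tjAC f D,
      (∀ α, coeff α μ ≠ 0 → α ∈ Λ ∧ P.deg α = D) ∧ h - μ - t ∈ suppGE K P.deg (D + 1) := by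
  classical
  have key : ∀ x ∈ Submodule.span K (P.grMonomial f '' Λ), ∃ μ : P.filt K D,
      (∀ α, coeff α (μ : MvPowerSeries (Fin n) K) ≠ 0 → α ∈ Λ ∧ P.deg α = D) ∧
        DirectSum.component K ℕ (fun d => P.grPiece f d) D x = P.grMk f D μ := by
    intro x hx
    induction hx using Submodule.span_induction with
    | mem x hx =>
      obtain ⟨α, hα, rfl⟩ := hx
      by_cases hD : P.deg α = D
      · subst hD
        refine ⟨P.monomialFilt K α, fun β hβ => ?_, DirectSum.component.lof_self ..⟩
        obtain rfl : β = α := by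
          by_contra hne
          exact hβ ((coeff_monomial _ _ _).trans (if_neg hne))
        exact ⟨hα, rfl⟩
      · refine ⟨0, fun β hβ => absurd (map_zero _) hβ, ?_⟩
        rw [map_zero, grMonomial, DirectSum.component.of, dif_neg hD]
    | zero => exact ⟨0, fun β hβ => absurd (map_zero _) hβ, by rw [map_zero, map_zero]⟩
    | add x y _ _ hx hy =>
      obtain ⟨μ, h1, h2⟩ := hx
      obtain ⟨μ', h1', h2'⟩ := hy
      refine ⟨μ + μ', fun α hα => ?_, by rw [map_add, map_add, h2, h2']⟩
      by_cases h0 : coeff α (μ : MvPowerSeries (Fin n) K) = 0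
      · refine h1' α fun h0' => hα ?_
        rw [Submodule.coe_add, map_add, h0, h0', add_zero]
      · exact h1 α h0
    | smul c x _ hx =>
      obtain ⟨μ, h1, h2⟩ := hx
      refine ⟨c • μ, fun α hα => h1 α fun h0 => hα ?_, by rw [map_smul, map_smul, h2]⟩
      change coeff α (c • (μ : MvPowerSeries (Fin n) K)) = 0
      rw [map_smul, h0, smul_zero]
  let h' : P.filt K D := ⟨h, P.mem_filt_iff.2 hh⟩
  obtain ⟨μ, hμ, hcomp⟩ := key (DirectSum.lof K ℕ (fun d => P.grPiece f d) D (P.grMk f D h'))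
    (by rw [hΛ.2]; trivial)
  rw [DirectSum.component.lof_self] at hcomp
  obtain ⟨t, ht, hr⟩ := P.exists_of_grMk_eq_zero (f := f) (h := h' - μ)
    (by rw [map_sub, hcomp, sub_self])
  exact ⟨μ, P.mem_filt_iff.1 μ.2, t, ht, hμ, hr⟩

end graded

/-! ### Finiteness of the Tjurina algebra -/

section Tjurina

/-- Successive approximation by elements of a finitely generated ideal. -/
theorem exists_eq_sum_mul {ι : Type*} [Fintype ι] (t : ι → MvPowerSeries (Fin n) K) (D₁ : ℕ)
    (happ : ∀ D, D₁ ≤ D → ∀ h ∈ suppGE K P.deg D, ∃ c : ι → MvPowerSeries (Fin n) K,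
      (∀ i, c i ∈ suppGE K P.deg (D - D₁)) ∧ h - ∑ i, c i * t i ∈ suppGE K P.deg (D + 1))
    {h : MvPowerSeries (Fin n) K} (hh : h ∈ suppGE K P.deg D₁) :
    ∃ c : ι → MvPowerSeries (Fin n) K, h = ∑ i, c i * t i := by
  have happ' : ∀ (j : ℕ) (h : MvPowerSeries (Fin n) K), ∃ c : ι → MvPowerSeries (Fin n) K,
      h ∈ suppGE K P.deg (D₁ + j) → (∀ i, c i ∈ suppGE K P.deg j) ∧
        h - ∑ i, c i * t i ∈ suppGE K P.deg (D₁ + j + 1) := by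
    intro j h
    by_cases hj : h ∈ suppGE K P.deg (D₁ + j)
    · obtain ⟨c, hc, hr⟩ := happ _ (by omega) h hj
      exact ⟨c, fun _ => ⟨fun i => suppGE_anti (by omega) (hc i), hr⟩⟩
    · exact ⟨0, fun h' => absurd h' hj⟩
  choose c hc using happ'
  let C : ℕ → ι → MvPowerSeries (Fin n) K := fun j =>
    Nat.rec 0 (fun j x => x + c j (h - ∑ i, x i * t i)) j
  have hC : ∀ j, C (j + 1) = C j + c j (h - ∑ i, C j i * t i) := fun j => rfl
  have hrem : ∀ j, h - ∑ i, C j i * t i ∈ suppGE K P.deg (D₁ + j) := by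
    intro j
    induction j with
    | zero =>
      have : ∑ i, C 0 i * t i = 0 := Finset.sum_eq_zero fun i _ => zero_mul _
      rw [this, sub_zero]
      exact hh
    | succ j ih =>
      have := (hc j _ ih).2
      rw [sub_sub, ← Finset.sum_add_distrib] at this
      rw [hC, ← add_assoc]
      simpa only [Pi.add_apply, add_mul] using this
  choose L hL using fun i => exists_limit (v := P.deg) (fun j => C j i) fun j => by
    rw [hC, Pi.add_apply, add_sub_cancel_left]
    exact (hc j _ (hrem j)).1 i
  refine ⟨L, ?_⟩
  rw [← sub_eq_zero]
  refine eq_zero_of_forall_mem_suppGE (v := P.deg) fun j => ?_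
  have h1 : ∑ i, (L i - C j i) * t i ∈ suppGE K P.deg j :=
    sum_mem fun i _ => P.mul_mem_suppGE_deg_left (hL i j)
  convert sub_mem (suppGE_anti (show j ≤ D₁ + j by omega) (hrem j)) h1 using 1
  simp only [sub_mul, Finset.sum_sub_distrib]
  ring

theorem finiteDimensional_quotient (I : Ideal (MvPowerSeries (Fin n) K)) (D : ℕ)
    (hI : ∀ h ∈ suppGE K P.deg D, h ∈ I) :
    FiniteDimensional K (MvPowerSeries (Fin n) K ⧸ I) := by
  classical
  let s := (P.finite_deg_lt D).toFinset
  refine ⟨⟨s.image fun α => Ideal.Quotient.mkₐ K I (monomial α 1), ?_⟩⟩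
  rw [eq_top_iff]
  rintro x -
  obtain ⟨h, rfl⟩ := Ideal.Quotient.mkₐ_surjective K I x
  have h1 : Ideal.Quotient.mkₐ K I (h - ∑ α ∈ s, monomial α (coeff α h)) = 0 :=
    Ideal.Quotient.eq_zero_iff_mem.2 (hI _ (sub_sum_monomial_mem_suppGE _ _))
  rw [map_sub, sub_eq_zero, map_sum] at h1
  rw [h1]
  refine sum_mem fun α hα => ?_
  have h2 : monomial α (coeff α h) = coeff α h • (monomial α 1 : MvPowerSeries (Fin n) K) := by
    rw [← map_smul, smul_eq_mul, mul_one]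
  rw [h2, map_smul]
  exact Submodule.smul_mem _ _ (Submodule.subset_span
    (Finset.mem_coe.2 (Finset.mem_image_of_mem _ hα)))

/-- In large degrees AAC approximates by combinations of `f` and its partial derivatives whose
coefficients have growing valuation, so their sums converge and the approximation becomes an
equality. -/
theorem finiteDimensional_tjurinaAlgebra {f : MvPowerSeries (Fin n) K} {d : ℕ}
    (hval : P.val f = d) (hf : P.AAC f) : FiniteDimensional K (TjurinaAlgebra f) := by
  obtain ⟨D₀, h0⟩ := hf.exists_forall_mem_tjAC
  refine P.finiteDimensional_quotient _ (max D₀ d) fun h hh => ?_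
  let t : Option (Fin n) → MvPowerSeries (Fin n) K := fun o => o.elim f fun i => pderiv K i f
  have ht : ∀ o, t o ∈ tjurinaIdeal f := by
    rintro (_ | i)
    · exact Ideal.subset_span (Set.mem_insert _ _)
    · exact Ideal.subset_span (Set.mem_insert_of_mem _ ⟨i, rfl⟩)
  obtain ⟨c, rfl⟩ := P.exists_eq_sum_mul t (max D₀ d) (fun D hD h hh => by
    obtain ⟨x, hx, hr⟩ := h0 D (le_of_max_le_left hD) h hh
    obtain ⟨g, ξ, rfl, hg, hξ⟩ := P.exists_of_mem_tjAC hval (le_of_max_le_right hD) hx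
    refine ⟨fun o => o.elim g fun i => ξ (X i), ?_, ?_⟩
    · rintro (_ | i)
      · exact suppGE_anti (by omega) hg
      · rw [mem_suppGE_deg_iff]
        exact fun w hw => suppGE_anti (by omega) (hξ w hw i)
    · rw [Fintype.sum_option]
      rwa [derivation_apply_eq_sum] at hr) hh
  exact sum_mem fun i _ => Ideal.mul_mem_left _ _ (ht i)

end Tjurina

end CPolytope

end

/-! ### Determinacy and normal forms -/

theorem corollary4p6 {n : ℕ} (hn : 1 ≤ n) {K : Type*} [Field K] [IsAlgClosed K]
    (P : CPolytope n) (f : MvPowerSeries (Fin n) K)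
    (hf : MvPowerSeries.constantCoeff f = 0)
    (hAAC : P.AAC (P.initialForm f)) :
    FinitelyContactDetermined f ∧
    P.CSPH f ∧
    (∃ Λ : Finset (Fin n →₀ ℕ), P.IsRegularBasis (P.initialForm f) (Λ : Set (Fin n →₀ ℕ))) ∧
    ∀ Λ : Set (Fin n →₀ ℕ), P.IsRegularBasis (P.initialForm f) Λ →
      ∃ (hΛ : Λ.Finite) (c : (Fin n →₀ ℕ) → K),
        ContactEquiv f (P.initialForm f +
          ∑ α ∈ hΛ.toFinset with P.val (P.initialForm f) < (P.deg α : EReal),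
            MvPowerSeries.monomial α (c α)) := by
  have hf0 : f ≠ 0 := by
    rintro rfl
    refine hAAC.ne_zero hn (MvPowerSeries.ext fun α => ?_)
    rw [P.coeff_initialForm_of_forall_le fun β hβ => absurd (map_zero _) hβ]
  obtain ⟨d, hval, hmem, hsub⟩ := P.initialForm_spec hf0
  refine ⟨?_, P.finiteDimensional_tjurinaAlgebra hval hAAC, P.exists_isRegularBasis hAAC, ?_⟩
  · obtain ⟨D₀, h0⟩ := hAAC.exists_forall_mem_tjAC
    refine ⟨max D₀ (d + 1), fun g hg => ?_⟩
    have hfg : f - g ∈ MvPowerSeries.suppGE K P.deg (max D₀ (d + 1)) := fun α hα => by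
      rw [map_sub, hg α ((P.degree_le_deg α).trans hα.le), sub_self]
    have hgf : g - P.initialForm f ∈ MvPowerSeries.suppGE K P.deg (d + 1) := by
      convert sub_mem hsub (MvPowerSeries.suppGE_anti (le_max_right _ _) hfg) using 1
      ring
    -- With `S` empty nothing may remain, so `f` is carried to `g` itself.
    obtain ⟨ν, hν, hc⟩ := P.exists_contactEquiv_add ∅ hval hmem
      (lt_of_lt_of_le (Nat.lt_succ_self d) (le_max_right D₀ _)) (fun D hD h hh => by
        obtain ⟨t, ht, hr⟩ := h0 D (le_of_max_le_left hD) h hh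
        exact ⟨0, zero_mem _, t, ht, fun α hα => absurd (map_zero _) hα, by rwa [sub_zero]⟩)
      hgf hfg
    have : ν = 0 := MvPowerSeries.ext fun α => by
      by_contra h
      exact hν α h
    rwa [this, add_zero] at hc
  · intro Λ hΛ
    refine ⟨hΛ.finite hAAC, ?_⟩
    -- Here the target is the initial form and the reduction starts at level `d + 1`, so only basis
    -- monomials of degree above `d` are left over.
    obtain ⟨ν, hν, hc⟩ := P.exists_contactEquiv_add {α | α ∈ Λ ∧ d < P.deg α} hval hmem
      (Nat.lt_succ_self d) (fun D hD h hh => by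
        obtain ⟨μ, hμ, t, ht, hS, hr⟩ := hΛ.exists_sub_mem hh
        exact ⟨μ, hμ, t, ht, fun α hα => ⟨(hS α hα).1, by rw [(hS α hα).2]; exact hD⟩, hr⟩)
      (by rw [sub_self]; exact zero_mem _) hsub
    refine ⟨fun α => MvPowerSeries.coeff α ν, ?_⟩
    convert hc using 2
    classical
    ext β
    rw [map_sum]
    simp only [MvPowerSeries.coeff_monomial]
    rw [Finset.sum_ite_eq]
    split_ifs with h
    · rfl
    · by_contra hne
      obtain ⟨h1, h2⟩ := hν β (Ne.symm hne)
      refine h (Finset.mem_filter.2 ⟨(Set.Finite.mem_toFinset _).2 h1, ?_⟩)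
      rw [hval]
      exact_mod_cast h2
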